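/- Let $r\ge 3$ be an integer and let $W$ be a non-negative real random variable with $\mathbb{E}[W]<\infty$ that has a density $f$ with respect to Lebesgue measure; let $F(t)=\mathbb{P}(W\le t)$ be its distribution function. For a finite simple graph $G$ with node set $V\neq\emptyset$ and real node weights $(W_i)_{i\in V}$, the algorithm GREEDY repeatedly selects the remaining node of greatest weight and deletes it together with all its remaining neighbours, until no node remains; $\mathcal{IG}$ denotes the independent set of selected nodes and $W[\mathcal{IG}]=\sum_{i\in\mathcal{IG}}W_i$ its weight. Let the weights $W_i$, $i\in V$, be independent copies of $W$ (so that they are almost surely distinct and $\mathcal{IG}$ is almost surely well defined; ties may be broken arbitrarily by a fixed rule), and let $G(g,r)$ be the family of all finite non-empty $r$-regular simple graphs all of whose cycles have length at least $g$. Then $W[\mathcal{IG}]/|V|$ is integrable for every finite graph; for every $g$ the family $G(g,r)$ is non-empty and the values $\mathbb{E}\left[W[\mathcal{IG}]/|V|\right]$, $G\in G(g,r)$, are bounded; the integral below converges; and $$\lim_{g\to\infty}\ \inf_{G\in G(g,r)}\mathbb{E}\left[\frac{W[\mathcal{IG}]}{|V|}\right]=\lim_{g\to\infty}\ \sup_{G\in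 G(g,r)}\mathbb{E}\left[\frac{W[\mathcal{IG}]}{|V|}\right]=\int_0^\infty x\,\bigl(r-1-(r-2)F(x)\bigr)^{-\frac{r}{r-2}}f(x)\,dx .$$ -/

import Mathlib

open MeasureTheory Set Filter Topology

noncomputable section

namespace GreedyMWIS

/-- The nodes of greatest weight among the remaining nodes `R`. -/
def heaviest {V : Type} (w : V → ℝ) (R : Finset V) : Finset V :=
  open Classical in R.filter (fun i => ∀ j ∈ R, w j ≤ w i)

theorem heaviest_nonempty {V : Type} (w : V → ℝ) {R : Finset V} (h : R.Nonempty) :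
    (heaviest w R).Nonempty := by
  classical
  obtain ⟨i, hi, hmax⟩ := R.exists_max_image w h
  exact ⟨i, by simpa [heaviest] using ⟨hi, hmax⟩⟩

/-- A node of greatest weight among the remaining nodes `R`. It is the unique one when the weights
are distinct; ties are broken by a fixed rule which looks only at the set of heaviest nodes. -/
def pick {V : Type} (w : V → ℝ) (R : Finset V) (h : R.Nonempty) : V :=
  (heaviest_nonempty w h).choose

theorem pick_mem {V : Type} (w : V → ℝ) (R : Finset V) (h : R.Nonempty) : pick w R h ∈ R := by
  classical
  exact (Finset.mem_filter.mp (heaviest_nonempty w h).choose_spec).1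

/-- The nodes of `R` that are left after the node `i` has been selected: `i` itself and all the
neighbours of `i` are deleted. -/
def remove {V : Type} (G : SimpleGraph V) (i : V) (R : Finset V) : Finset V :=
  open Classical in R.filter (fun j => j ≠ i ∧ ¬ G.Adj i j)

theorem card_remove_lt {V : Type} (G : SimpleGraph V) {i : V} {R : Finset V} (hi : i ∈ R) :
    (remove G i R).card < R.card := by
  classical
  refine Finset.card_lt_card (Finset.filter_ssubset.mpr ⟨i, hi, ?_⟩)
  simp

/-- The set of nodes selected by GREEDY on the weighted graph `(G, w)` from the moment when `R` is
the set of remaining nodes: select the heaviest remaining node, delete it and its remaining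
neighbours, and repeat until no node remains. -/
def greedyFrom {V : Type} (G : SimpleGraph V) (w : V → ℝ) (R : Finset V) : Finset V :=
  open Classical in
  if h : R.Nonempty then
    insert (pick w R h) (greedyFrom G w (remove G (pick w R h) R))
  else ∅
termination_by R.card
decreasing_by exact card_remove_lt G (pick_mem w R h)

/-- The independent set returned by GREEDY on the weighted graph `(G, w)`. -/
def greedy {V : Type} [Fintype V] (G : SimpleGraph V) (w : V → ℝ) : Finset V :=
  greedyFrom G w Finset.univ

/-- The weight of the independent set returned by GREEDY, divided by the number of nodes. -/
def greedyRatio {V : Type} [Fintype V] (G : SimpleGraph V) (w : V → ℝ) : ℝ :=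
  (∑ i ∈ greedy G w, w i) / (Fintype.card V : ℝ)

/-- `G` is `r`-regular and has girth at least `g`, i.e. all its cycles have length at least `g`. -/
def IsRegularOfGirthGE {V : Type} [Fintype V] (g r : ℕ) (G : SimpleGraph V) : Prop :=
  open Classical in G.IsRegularOfDegree r ∧ (g : ℕ∞) ≤ G.egirth

/-- The set of all values of the expected ratio of GREEDY, for i.i.d. node weights of law `ν`, on
the (finite, non-empty) `r`-regular graphs of girth at least `g`. -/
def expectedRatios (ν : Measure ℝ) (g r : ℕ) : Set ℝ :=
  {x | ∃ (V : Type) (_ : Fintype V) (_ : Nonempty V) (G : SimpleGraph V),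
    IsRegularOfGirthGE g r G ∧
      x = ∫ w, greedyRatio G w ∂(Measure.pi (fun _ : V => ν))}

end GreedyMWIS

end

/-! Almost surely the weights are distinct, and then a node is selected exactly when none of its
heavier neighbours is (`mem_greedyFrom_iff`). Unfold this rule away from a node and stop at depth n
by declaring every node there selected: since each level negates, the truncations over- and
underestimate selection alternately (`selects_squeeze`). If the girth is large compared with n, the
unfolding sees only a tree. The branches at a node then use disjoint sets of independent weights, so
the selection probability given the weight obeys a one-dimensional recursion (`integral_selects`),
the same for every r-regular graph. Hence the expected ratios of all these graphs lie between two
consecutive terms of a single sequence, `rootValue` (`integral_greedyRatio_mem_Icc`).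

In terms of the quantile u = F(x), which is uniform on [0,1] (`map_cdf`), the recursion is the
Picard iteration for q(u) = 1 - ∫_u^1 q^(r-1), that is, q' = q^(r-1) with q(1) = 1. Separating
variables gives q(u) = (r-1-(r-2)u)^(-1/(r-2)), and the error carries the factor (r-1)^n/(n+1)!
(`abs_one_sub_integral_quantileProb_sub_le`). A root has r children and so contributes q^r;
dominated convergence yields the integral.

Graphs of every girth are supplied by a Cayley graph generated by r involutions of a ball in the
regular tree (`le_egirth_largeGirthGraph`). -/

noncomputable section

namespace GreedyMWIS

/-! ### The local selection rule of GREEDY -/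

theorem remove_ssubset {V : Type} (G : SimpleGraph V) {i : V} {R : Finset V} (hi : i ∈ R) :
    remove G i R ⊂ R := by
  classical
  exact Finset.filter_ssubset.mpr ⟨i, hi, by simp⟩

theorem mem_remove {V : Type} {G : SimpleGraph V} {i j : V} {R : Finset V} :
    j ∈ remove G i R ↔ j ∈ R ∧ j ≠ i ∧ ¬ G.Adj i j := by
  classical
  simp [remove]

theorem mem_greedyFrom_of_nonempty {V : Type} (G : SimpleGraph V) (w : V → ℝ) {R : Finset V}
    (h : R.Nonempty) {i : V} :
    i ∈ greedyFrom G w R ↔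
      i = pick w R h ∨ i ∈ greedyFrom G w (remove G (pick w R h) R) := by
  classical
  rw [greedyFrom]
  simp [h]

theorem greedyFrom_empty {V : Type} (G : SimpleGraph V) (w : V → ℝ) :
    greedyFrom G w ∅ = ∅ := by
  rw [greedyFrom]
  simp

theorem greedyFrom_subset {V : Type} (G : SimpleGraph V) (w : V → ℝ) (R : Finset V) :
    greedyFrom G w R ⊆ R := by
  induction R using Finset.strongInduction with
  | H R ih =>
    rcases R.eq_empty_or_nonempty with rfl | h
    · simp [greedyFrom_empty]
    · intro i hi
      rcases (mem_greedyFrom_of_nonempty G w h).mp hi with rfl | hi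
      · exact pick_mem w R h
      · exact (remove_ssubset G (pick_mem w R h)).1 (ih _ (remove_ssubset G (pick_mem w R h)) hi)

theorem le_pick {V : Type} (w : V → ℝ) (R : Finset V) (h : R.Nonempty) {j : V} (hj : j ∈ R) :
    w j ≤ w (pick w R h) := by
  classical
  exact (Finset.mem_filter.mp (heaviest_nonempty w h).choose_spec).2 j hj

/-- For distinct weights, a node is selected by GREEDY if and only if none of its heavier
neighbours is. -/
theorem mem_greedyFrom_iff {V : Type} (G : SimpleGraph V) {w : V → ℝ} (hw : w.Injective)
    (R : Finset V) {i : V} (hi : i ∈ R) :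
    i ∈ greedyFrom G w R ↔
      ∀ j ∈ R, G.Adj i j → w i < w j → j ∉ greedyFrom G w R := by
  induction R using Finset.strongInduction with
  | H R ih =>
    have h : R.Nonempty := ⟨i, hi⟩
    simp only [mem_greedyFrom_of_nonempty G w h]
    have hm : ∀ {j}, j ∈ R → w j ≤ w (pick w R h) := le_pick w R h
    have hmR := pick_mem w R h
    generalize pick w R h = m at hm hmR ⊢
    have hsub := greedyFrom_subset G w (remove G m R)
    by_cases him : i = m
    · subst him
      simp only [true_or, true_iff]
      intro j hj _ hlt
      exact absurd hlt (not_lt.mpr (hm hj))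
    by_cases hadj : G.Adj m i
    · refine iff_of_false ?_ ?_
      · rintro (h1 | h1)
        · exact him h1
        · exact (mem_remove.mp (hsub h1)).2.2 hadj
      · intro hall
        exact hall m hmR hadj.symm
          (lt_of_le_of_ne (hm hi) (fun h => him (hw h))) (Or.inl rfl)
    -- Heavier neighbours of `i` lost in the deletion do not matter: they are neighbours of `m`,
    -- hence not selected, and `m` itself is not adjacent to `i`.
    · have hi' : i ∈ remove G m R := mem_remove.mpr ⟨hi, him, hadj⟩
      rw [or_iff_right him, ih _ (remove_ssubset G hmR) hi']
      constructor
      · rintro hall j hj hij hlt (rfl | hjg)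
        · exact hadj hij.symm
        · exact hall j (hsub hjg) hij hlt hjg
      · intro hall j hj hij hlt hjg
        exact hall j (mem_remove.mp hj).1 hij hlt (Or.inr hjg)

theorem mem_greedy_iff {V : Type} [Fintype V] (G : SimpleGraph V) {w : V → ℝ}
    (hw : w.Injective) {i : V} :
    i ∈ greedy G w ↔ ∀ j, G.Adj i j → w i < w j → j ∉ greedy G w := by
  simpa [greedy] using mem_greedyFrom_iff G hw Finset.univ (Finset.mem_univ i)

theorem pick_congr {V : Type} {w w' : V → ℝ} (h : ∀ i j, w i ≤ w j ↔ w' i ≤ w' j)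
    (R : Finset V) (hR : R.Nonempty) : pick w R hR = pick w' R hR := by
  -- The tie-breaking choice sees only the set of heaviest nodes, so equal sets give equal choices.
  have key : ∀ (S T : Finset V) (hS : S.Nonempty) (hT : T.Nonempty), S = T →
      hS.choose = hT.choose := by
    rintro S _ _ _ rfl
    rfl
  refine key _ _ _ _ ?_
  simp [heaviest, h]

/-- GREEDY depends only on the order of the weights. -/
theorem greedyFrom_congr {V : Type} (G : SimpleGraph V) {w w' : V → ℝ}
    (h : ∀ i j, w i ≤ w j ↔ w' i ≤ w' j) (R : Finset V) :
    greedyFrom G w R = greedyFrom G w' R := by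
  induction R using Finset.strongInduction with
  | H R ih =>
    rcases R.eq_empty_or_nonempty with rfl | hR
    · simp [greedyFrom_empty]
    · ext i
      rw [mem_greedyFrom_of_nonempty G w hR, mem_greedyFrom_of_nonempty G w' hR,
        ← pick_congr h, ih _ (remove_ssubset G (pick_mem w R hR))]

/-! ### Measurability, integrability and absence of ties -/

/-- Selection is decided by the order pattern of the weights, which is measurable and takes finitely
many values. -/
theorem measurableSet_mem_greedy {V : Type} [Fintype V] (G : SimpleGraph V) (i : V) :
    MeasurableSet {w : V → ℝ | i ∈ greedy G w} := by
  let pattern : (V → ℝ) → V → V → Prop := fun w j k => w j ≤ w k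
  have hp : Measurable pattern := by
    refine measurable_pi_iff.mpr fun j => measurable_pi_iff.mpr fun k => ?_
    exact measurableSet_setOfPred.mp (measurableSet_le (measurable_pi_apply j) (measurable_pi_apply k))
  have heq : {w : V → ℝ | i ∈ greedy G w} = pattern ⁻¹' (pattern '' {w | i ∈ greedy G w}) := by
    refine (subset_preimage_image _ _).antisymm ?_
    rintro w ⟨w', hw', hww'⟩
    have : greedy G w' = greedy G w :=
      greedyFrom_congr G (fun j k => by
        have := congrFun (congrFun hww' j) k
        exact iff_of_eq this) _
    simpa [← this] using hw'
  rw [heq]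
  exact hp (Set.toFinite _).measurableSet

theorem greedyRatio_eq_sum_indicator {V : Type} [Fintype V] (G : SimpleGraph V) (w : V → ℝ) :
    greedyRatio G w = (∑ i, {w : V → ℝ | i ∈ greedy G w}.indicator (fun w => w i) w) /
      (Fintype.card V : ℝ) := by
  classical
  simp only [greedyRatio, indicator, mem_ofPred_eq, Finset.sum_ite_mem, Finset.univ_inter]

theorem integrable_eval {V : Type} [Fintype V] {ν : Measure ℝ} [IsProbabilityMeasure ν]
    (hν : Integrable (fun x => x) ν) (i : V) :
    Integrable (fun w : V → ℝ => w i) (Measure.pi (fun _ : V => ν)) :=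
  (measurePreserving_eval (fun _ : V => ν) i).integrable_comp_of_integrable hν

theorem integral_eval {V : Type} [Fintype V] {ν : Measure ℝ} [IsProbabilityMeasure ν] (i : V)
    {φ : ℝ → ℝ} (hφ : AEStronglyMeasurable φ ν) :
    ∫ w : V → ℝ, φ (w i) ∂(Measure.pi (fun _ : V => ν)) = ∫ x, φ x ∂ν := by
  have h := measurePreserving_eval (fun _ : V => ν) i
  rw [← h.map_eq] at hφ
  rw [← integral_map h.measurable.aemeasurable hφ, h.map_eq]

theorem integrable_indicator_greedy {V : Type} [Fintype V] {ν : Measure ℝ}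
    [IsProbabilityMeasure ν] (hν : Integrable (fun x => x) ν) (G : SimpleGraph V) (i : V) :
    Integrable ({w : V → ℝ | i ∈ greedy G w}.indicator (fun w => w i))
      (Measure.pi (fun _ : V => ν)) :=
  (integrable_eval hν i).indicator (measurableSet_mem_greedy G i)

theorem integrable_greedyRatio {V : Type} [Fintype V] {ν : Measure ℝ} [IsProbabilityMeasure ν]
    (hν : Integrable (fun x => x) ν) (G : SimpleGraph V) :
    Integrable (greedyRatio G) (Measure.pi (fun _ : V => ν)) := by
  rw [funext (greedyRatio_eq_sum_indicator G)]
  exact (integrable_finsetSum _ fun i _ => integrable_indicator_greedy hν G i).div_const _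

theorem integral_greedyRatio {V : Type} [Fintype V] {ν : Measure ℝ} [IsProbabilityMeasure ν]
    (hν : Integrable (fun x => x) ν) (G : SimpleGraph V) :
    ∫ w, greedyRatio G w ∂(Measure.pi (fun _ : V => ν)) =
      (∑ i, ∫ w, {w : V → ℝ | i ∈ greedy G w}.indicator (fun w => w i) w
        ∂(Measure.pi (fun _ : V => ν))) / (Fintype.card V : ℝ) := by
  simp_rw [greedyRatio_eq_sum_indicator G]
  rw [integral_div, integral_finsetSum _ fun i _ => integrable_indicator_greedy hν G i]

/-- Independent weights with an atomless law are almost surely distinct. -/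
theorem ae_injective_pi {V : Type} [Fintype V] {ν : Measure ℝ} [IsProbabilityMeasure ν]
    [NullSingletonClass ν] : ∀ᵐ w : V → ℝ ∂(Measure.pi (fun _ : V => ν)), w.Injective := by
  have key : ∀ i j : V, i ≠ j →
      ∀ᵐ w : V → ℝ ∂(Measure.pi (fun _ : V => ν)), w i ≠ w j := by
    intro i j hij
    have hind : ProbabilityTheory.IndepFun (fun w : V → ℝ => w i) (fun w => w j)
        (Measure.pi (fun _ : V => ν)) :=
      (ProbabilityTheory.iIndepFun_pi (X := fun (_ : V) (x : ℝ) => x)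
        (fun _ => aemeasurable_id)).indepFun hij
    have hmap := (ProbabilityTheory.indepFun_iff_map_prod_eq_prod_map_map
      (measurable_pi_apply i).aemeasurable (measurable_pi_apply j).aemeasurable).mp hind
    have hi : Measure.map (fun w : V → ℝ => w i) _ = ν :=
      (measurePreserving_eval (fun _ : V => ν) i).map_eq
    have hj : Measure.map (fun w : V → ℝ => w j) _ = ν :=
      (measurePreserving_eval (fun _ : V => ν) j).map_eq
    rw [hi, hj] at hmap
    -- By Fubini the diagonal is null, each of its sections being a single point.
    have hdiag : ∀ᵐ x : ℝ × ℝ ∂(ν.prod ν), x.1 ≠ x.2 := by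
      refine (Measure.ae_prod_iff_ae_ae (p := fun x : ℝ × ℝ => x.1 ≠ x.2)
        (measurableSet_eq_fun measurable_fst measurable_snd).compl).mpr
        (Eventually.of_forall fun x => ?_)
      have : ({x} : Set ℝ)ᶜ ∈ ae ν := compl_mem_ae_iff.mpr (measure_singleton x)
      filter_upwards [this] with y hy h
      exact hy h.symm
    rw [← hmap] at hdiag
    exact ae_of_ae_map ((measurable_pi_apply i).prodMk (measurable_pi_apply j)).aemeasurable hdiag
  have : ∀ᵐ w : V → ℝ ∂(Measure.pi (fun _ : V => ν)), ∀ i j : V, i ≠ j → w i ≠ w j := by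
    rw [ae_all_iff]; intro i; rw [ae_all_iff]; intro j
    by_cases hij : i = j
    · simp [hij]
    · filter_upwards [key i j hij] with w hw _ using hw
  filter_upwards [this] with w hw i j hij
  by_contra hne
  exact hw i j hne hij

/-! ### Truncated recursion -/

/-- The depth-`n` truncation of the recursion which decides whether GREEDY selects `v`, looking
only at the neighbours other than the parent `p`. -/
def Selects {V : Type} (G : SimpleGraph V) (w : V → ℝ) : ℕ → V → V → Prop
  | 0, _, _ => True
  | n + 1, p, v => ∀ u, G.Adj v u → u ≠ p → w v < w u → ¬ Selects G w n v u

/-- The truncated recursion at a root, which has no parent. -/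
def RootSelects {V : Type} (G : SimpleGraph V) (w : V → ℝ) (n : ℕ) (v : V) : Prop :=
  ∀ u, G.Adj v u → w v < w u → ¬ Selects G w n v u

/-- Truncation at even depth gives upper bounds and truncation at odd depth lower bounds. -/
theorem selects_squeeze {V : Type} [Fintype V] (G : SimpleGraph V) {w : V → ℝ}
    (hw : w.Injective) (m : ℕ) :
    (∀ p v, v ∈ greedy G w → Selects G w (2 * m) p v) ∧
    (∀ p v, w p < w v → Selects G w (2 * m + 1) p v → v ∈ greedy G w) := by
  -- A parent lighter than `v` plays no role in the rule at `v`, so leaving it out loses nothing;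
  -- the recursion only descends to nodes heavier than their parent.
  have step : ∀ n, (∀ p v, v ∈ greedy G w → Selects G w n p v) →
      ∀ p v, w p < w v → Selects G w (n + 1) p v → v ∈ greedy G w := by
    intro n hn p v hpv hs
    rw [mem_greedy_iff G hw]
    intro u huv hlt hu
    refine hs u huv ?_ hlt (hn v u hu)
    rintro rfl
    exact lt_asymm hpv hlt
  have heven : ∀ p v, v ∈ greedy G w → Selects G w (2 * m) p v := by
    induction m with
    | zero => intro p v _; trivial
    | succ m ih =>
      intro p v hv u huv _ hlt hs
      exact (mem_greedy_iff G hw).mp hv u huv hlt (step _ ih v u hlt hs)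
  exact ⟨heven, step _ heven⟩

/-- The negation at the root exchanges upper and lower bounds, so the parity is opposite to that for
the children. -/
theorem mem_greedy_of_rootSelects {V : Type} [Fintype V] (G : SimpleGraph V) {w : V → ℝ}
    (hw : w.Injective) {m : ℕ} {v : V} (h : RootSelects G w (2 * m) v) : v ∈ greedy G w :=
  (mem_greedy_iff G hw).mpr fun u huv hlt hu =>
    h u huv hlt ((selects_squeeze G hw m).1 v u hu)

theorem rootSelects_of_mem_greedy {V : Type} [Fintype V] (G : SimpleGraph V) {w : V → ℝ}
    (hw : w.Injective) {m : ℕ} {v : V} (h : v ∈ greedy G w) : RootSelects G w (2 * m + 1) v :=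
  fun u huv hlt hs =>
    (mem_greedy_iff G hw).mp h u huv hlt ((selects_squeeze G hw m).2 v u hlt hs)

theorem measurableSet_selects {V : Type} [Fintype V] (G : SimpleGraph V) (n : ℕ) :
    ∀ p v : V, MeasurableSet {w : V → ℝ | Selects G w n p v} := by
  induction n with
  | zero => intro p v; simp [Selects]
  | succ n ih =>
    intro p v
    have : {w : V → ℝ | Selects G w (n + 1) p v} =
        ⋂ u, ⋂ (_ : G.Adj v u), ⋂ (_ : u ≠ p),
          ({w : V → ℝ | w v < w u} ∩ {w | Selects G w n v u})ᶜ := by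
      ext w
      simp [Selects]
    rw [this]
    exact MeasurableSet.iInter fun u => MeasurableSet.iInter fun _ => MeasurableSet.iInter fun _ =>
      ((measurableSet_lt (measurable_pi_apply v) (measurable_pi_apply u)).inter (ih v u)).compl

/-! ### Branches in graphs of large girth -/

/-- The nodes which can be reached from `v` by a walk of length at most `n` avoiding `p`. -/
def branch {V : Type} (G : SimpleGraph V) (n : ℕ) (p v : V) : Set V :=
  {z | ∃ q : G.Walk v z, q.length ≤ n ∧ p ∉ q.support}

/-- Two distinct neighbours of `v` are not joined by a short walk avoiding `v`. -/
theorem lt_length_of_egirth {V : Type} {G : SimpleGraph V} {m : ℕ} (hG : (m + 3 : ℕ) ≤ G.egirth)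
    {v a b : V} (ha : G.Adj v a) (hb : G.Adj v b) (hab : a ≠ b) (q : G.Walk a b)
    (hq : v ∉ q.support) : m < q.length := by
  classical
  by_contra! hle
  have hq' : v ∉ q.bypass.support := fun h => hq (q.support_bypass_subset_support h)
  -- The path extracted from `q`, closed up through `v`, is a cycle of length at most `m + 2`.
  have hp : (q.bypass.concat hb.symm).IsPath := q.bypass_isPath.concat hq' hb.symm
  have hc : (SimpleGraph.Walk.cons ha (q.bypass.concat hb.symm)).IsCycle := by
    rw [SimpleGraph.Walk.cons_isCycle_iff]
    refine ⟨hp, ?_⟩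
    rw [SimpleGraph.Walk.edges_concat]
    simp only [List.concat_eq_append, List.mem_append, List.mem_singleton, not_or]
    refine ⟨fun h => hq' (SimpleGraph.Walk.fst_mem_support_of_mem_edges _ h), ?_⟩
    rw [Sym2.eq_iff]
    rintro (⟨rfl, rfl⟩ | ⟨_, h⟩)
    · exact hab rfl
    · exact hab h
  have h := hG.trans (SimpleGraph.egirth_le_length hc)
  have hlen := q.length_bypass_le_length
  simp only [SimpleGraph.Walk.length_cons, SimpleGraph.Walk.length_concat] at h
  have := ENat.natCast_le_natCast.mp h
  omega

theorem mem_branch_self {V : Type} (G : SimpleGraph V) (n : ℕ) {p v : V} (h : p ≠ v) :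
    v ∈ branch G n p v := ⟨SimpleGraph.Walk.nil, by simp, by simpa using h⟩

theorem notMem_branch {V : Type} (G : SimpleGraph V) (n : ℕ) (p v : V) :
    p ∉ branch G n p v := fun ⟨q, _, hq⟩ => hq q.end_mem_support

/-- If a short walk from `u` avoiding `v` met `p`, two neighbours of `v` would be joined by a walk
of length at most `n`, against the girth. -/
theorem branch_subset {V : Type} {G : SimpleGraph V} {n : ℕ} (hG : (n + 3 : ℕ) ≤ G.egirth)
    {p v u : V} (hp : G.Adj v p) (hu : G.Adj v u) (hup : u ≠ p) :
    branch G n v u ⊆ branch G (n + 1) p v := by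
  classical
  rintro z ⟨q, hq, hvq⟩
  refine ⟨SimpleGraph.Walk.cons hu q, by simpa using hq, ?_⟩
  rw [SimpleGraph.Walk.support_cons, List.mem_cons, not_or]
  refine ⟨hp.ne', fun hpq => ?_⟩
  have h1 := lt_length_of_egirth hG hu hp hup (q.takeUntil p hpq)
    (fun h => hvq (q.support_takeUntil_subset_support hpq h))
  have h2 := q.length_takeUntil_le_length hpq
  omega

/-- A common node would give a walk of length at most `2 * n` from `a` to `b` avoiding `v`. -/
theorem disjoint_branch {V : Type} {G : SimpleGraph V} {n : ℕ}
    (hG : (2 * n + 3 : ℕ) ≤ G.egirth) {v a b : V} (ha : G.Adj v a) (hb : G.Adj v b)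
    (hab : a ≠ b) : Disjoint (branch G n v a) (branch G n v b) := by
  rw [Set.disjoint_left]
  rintro z ⟨q, hq, hvq⟩ ⟨q', hq', hvq'⟩
  have h := lt_length_of_egirth hG ha hb hab (q.append q'.reverse) (by
    simp [SimpleGraph.Walk.mem_support_append_iff, hvq, hvq'])
  simp only [SimpleGraph.Walk.length_append, SimpleGraph.Walk.length_reverse] at h
  omega

theorem dependsOn_selects {V : Type} {G : SimpleGraph V} (n : ℕ)
    (hG : (n + 2 : ℕ) ≤ G.egirth) :
    ∀ p v : V, G.Adj v p → DependsOn (fun w : V → ℝ => Selects G w n p v) (branch G n p v) := by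
  induction n with
  | zero => intro p v _ w w' _; rfl
  | succ n ih =>
    intro p v hp w w' hww
    have hG' : ((n + 3 : ℕ) : ℕ∞) ≤ G.egirth := by convert hG using 1
    have hv := hww v (mem_branch_self G _ hp.ne')
    simp only [Selects]
    refine forall_congr fun u => forall_congr fun hu => forall_congr fun hup => ?_
    have hsub := branch_subset hG' hp hu hup
    have hwu := hww u (hsub (mem_branch_self G n hu.ne))
    have hs := ih (le_trans (by exact_mod_cast Nat.le_succ _) hG') v u hu.symm
      (fun z hz => hww z (hsub hz))
    simp only at hs
    rw [hv, hwu, hs]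

/-! ### Independence under the product measure -/

/-- Under a product measure, events which depend on disjoint sets of coordinates are
independent. -/
theorem measure_inter_of_dependsOn {V : Type} [Fintype V] {ν : Measure ℝ}
    [IsProbabilityMeasure ν] {S T : Set (V → ℝ)} (hS : MeasurableSet S) (hT : MeasurableSet T)
    {D E : Set V} (hDE : Disjoint D E) (hSD : DependsOn (fun w => w ∈ S) D)
    (hTE : DependsOn (fun w => w ∈ T) E) :
    (Measure.pi (fun _ : V => ν)).real (S ∩ T) =
      (Measure.pi (fun _ : V => ν)).real S * (Measure.pi (fun _ : V => ν)).real T := by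
  classical
  -- Padding by zero turns an event depending only on the coordinates in `A` into the preimage of an
  -- event on `A → ℝ`.
  let ext : ∀ A : Finset V, (A → ℝ) → V → ℝ := fun A z i => if h : i ∈ A then z ⟨i, h⟩ else 0
  have hext : ∀ A : Finset V, Measurable (ext A) := by
    intro A
    refine measurable_pi_iff.mpr fun i => ?_
    by_cases h : i ∈ A
    · simpa [ext, h] using measurable_pi_apply _
    · simp [ext, h]
  have hpre : ∀ (A : Set V) (U : Set (V → ℝ)), DependsOn (fun w => w ∈ U) A →
      (fun (w : V → ℝ) (i : A.toFinset) => w i) ⁻¹' (ext A.toFinset ⁻¹' U) = U := by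
    intro A U hU
    ext w
    refine iff_of_eq (hU fun i hi => ?_)
    simp [ext, hi]
  have hind := (ProbabilityTheory.iIndepFun_pi (μ := fun _ : V => ν)
    (X := fun (_ : V) (x : ℝ) => x) (fun _ => aemeasurable_id)).indepFun_finset
    D.toFinset E.toFinset (by simpa using hDE) (fun i => measurable_pi_apply i)
  have h := hind.measure_inter_preimage_eq_mul _ _ (hext _ hS) (hext _ hT)
  rw [hpre D S hSD, hpre E T hTE] at h
  simp [measureReal_def, h]

theorem measureReal_iInter_of_dependsOn {V : Type} [Fintype V] {ν : Measure ℝ}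
    [IsProbabilityMeasure ν] (N : Finset V) {C : V → Set (V → ℝ)}
    (hC : ∀ u, MeasurableSet (C u)) {D : V → Set V}
    (hD : (N : Set V).PairwiseDisjoint D) (hCD : ∀ u ∈ N, DependsOn (fun w => w ∈ C u) (D u)) :
    (Measure.pi (fun _ : V => ν)).real (⋂ u ∈ N, C u) =
      ∏ u ∈ N, (Measure.pi (fun _ : V => ν)).real (C u) := by
  classical
  induction N using Finset.induction_on with
  | empty => simp
  | insert a N ha ih =>
    rw [Finset.prod_insert ha, Finset.set_biInter_insert,
      measure_inter_of_dependsOn (hC a) (Finset.measurableSet_biInter N fun u _ => hC u)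
        (D := D a) (E := ⋃ u ∈ N, D u) ?_ (hCD a (by simp)) ?_, ih]
    · exact hD.subset (by simp)
    · exact fun u hu => hCD u (by simp [hu])
    · refine Set.disjoint_iUnion₂_right.mpr fun u hu => hD (by simp) (by simp [hu]) ?_
      rintro rfl
      exact ha hu
    · intro w w' hww
      simp only [mem_iInter]
      refine forall_congr fun u => forall_congr fun hu => hCD u (by simp [hu]) fun i hi => ?_
      exact hww i (by simp only [mem_iUnion]; exact ⟨u, hu, hi⟩)

/-- Resampling one coordinate preserves a product measure. -/
theorem measurePreserving_update {V : Type} [Fintype V] [DecidableEq V] {ν : Measure ℝ}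
    [IsProbabilityMeasure ν] (v : V) :
    MeasurePreserving (fun p : ℝ × (V → ℝ) => Function.update p.2 v p.1)
      (ν.prod (Measure.pi (fun _ : V => ν))) (Measure.pi (fun _ : V => ν)) := by
  have hm : Measurable (fun p : ℝ × (V → ℝ) => Function.update p.2 v p.1) := by
    refine measurable_pi_iff.mpr fun i => ?_
    by_cases h : i = v
    · subst h; simpa using measurable_fst
    · simpa [Function.update_of_ne h, Function.comp_def] using
        (measurable_pi_apply i).comp measurable_snd
  refine ⟨hm, (Measure.pi_eq fun s hs => ?_).symm⟩
  rw [Measure.map_apply hm (MeasurableSet.univ_pi hs)]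
  have : (fun p : ℝ × (V → ℝ) => Function.update p.2 v p.1) ⁻¹' (univ.pi s) =
      s v ×ˢ univ.pi (Function.update s v univ) := by
    ext ⟨y, w⟩
    simp only [mem_preimage, mem_univ_pi, mem_prod]
    constructor
    · intro h
      refine ⟨by simpa using h v, fun i => ?_⟩
      by_cases hi : i = v
      · subst hi; simp
      · simpa [Function.update_of_ne hi] using h i
    · rintro ⟨h1, h2⟩ i
      by_cases hi : i = v
      · subst hi; simpa using h1
      · simpa [Function.update_of_ne hi] using h2 i
  rw [this, Measure.prod_prod, Measure.pi_pi, ← Finset.mul_prod_erase _ _ (Finset.mem_univ v),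
    ← Finset.mul_prod_erase _ (fun i => ν (s i)) (Finset.mem_univ v)]
  simp only [Function.update_self, measure_univ, one_mul]
  congr 1
  refine Finset.prod_congr rfl fun i hi => ?_
  rw [Function.update_of_ne (Finset.ne_of_mem_erase hi)]

/-- One step of the recursion: the branches hanging off `v` are independent of one another and of
the weight of `v`. -/
theorem integral_indicator_forall_not {V : Type} [Fintype V] {ν : Measure ℝ}
    [IsProbabilityMeasure ν] (v : V) (N : Finset V) {E : V → Set (V → ℝ)}
    (hE : ∀ u, MeasurableSet (E u)) {D : V → Set V} (hD : (N : Set V).PairwiseDisjoint D)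
    (hED : ∀ u ∈ N, DependsOn (fun w => w ∈ E u) (D u)) (hv : ∀ u ∈ N, v ∉ D u)
    (hu : ∀ u ∈ N, u ∈ D u) {φ : ℝ → ℝ} (hφ : Integrable φ ν) :
    ∫ w, {w : V → ℝ | ∀ u ∈ N, w v < w u → w ∉ E u}.indicator (fun w => φ (w v)) w
        ∂(Measure.pi (fun _ : V => ν)) =
      ∫ x, φ x * ∏ u ∈ N, (1 - (Measure.pi (fun _ : V => ν)).real {w | x < w u ∧ w ∈ E u}) ∂ν := by
  classical
  set μ := Measure.pi (fun _ : V => ν) with hμ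
  set A : Set (V → ℝ) := {w | ∀ u ∈ N, w v < w u → w ∉ E u} with hA
  have hAm : MeasurableSet A := by
    have : A = ⋂ u ∈ N, ({w : V → ℝ | w v < w u} ∩ E u)ᶜ := by
      ext w; simp [hA]
    rw [this]
    exact Finset.measurableSet_biInter _ fun u _ =>
      ((measurableSet_lt (measurable_pi_apply v) (measurable_pi_apply u)).inter (hE u)).compl
  have hint : Integrable (A.indicator (fun w => φ (w v))) μ :=
    Integrable.indicator
      ((measurePreserving_eval (fun _ : V => ν) v).integrable_comp_of_integrable hφ) hAm
  have hmp := measurePreserving_update (ν := ν) v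
  rw [← hμ] at hmp
  have hsm := hint.aestronglyMeasurable
  rw [← hmp.map_eq] at hsm
  rw [show (∫ w, A.indicator (fun w => φ (w v)) w ∂μ) = _ from
    congrArg (fun m => ∫ w, A.indicator (fun w => φ (w v)) w ∂m) hmp.map_eq.symm,
    integral_map hmp.measurable.aemeasurable hsm, integral_prod]
  swap
  · exact hmp.integrable_comp_of_integrable hint
  refine integral_congr_ae (Eventually.of_forall fun x => ?_)
  -- Once the weight of `v` is replaced by `x`, the condition splits into one event per `u`,
  -- depending only on `D u`, because `u ∈ D u` and `v ∉ D u`.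
  have hset : ∀ w : V → ℝ, A.indicator (fun w => φ (w v)) (Function.update w v x) =
      (⋂ u ∈ N, ({w : V → ℝ | x < w u ∧ w ∈ E u})ᶜ).indicator (fun _ => φ x) w := by
    intro w
    have : Function.update w v x ∈ A ↔ w ∈ ⋂ u ∈ N, ({w : V → ℝ | x < w u ∧ w ∈ E u})ᶜ := by
      simp only [hA, mem_ofPred_eq, mem_iInter, mem_compl_iff, not_and]
      refine forall_congr' fun u => forall_congr' fun huN => ?_
      have huv : u ≠ v := by
        rintro rfl
        exact hv u huN (hu u huN)
      have : (Function.update w v x ∈ E u) = (w ∈ E u) := hED u huN fun i hi => by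
        rw [Function.update_of_ne]
        rintro rfl
        exact hv u huN hi
      rw [this, Function.update_self, Function.update_of_ne huv]
    by_cases h : Function.update w v x ∈ A
    · rw [indicator_of_mem h, indicator_of_mem (this.mp h), Function.update_self]
    · rw [indicator_of_notMem h, indicator_of_notMem (fun h' => h (this.mpr h'))]
  have hCm : ∀ u, MeasurableSet {w : V → ℝ | x < w u ∧ w ∈ E u} := fun u =>
    (measurableSet_lt measurable_const (measurable_pi_apply u)).inter (hE u)
  simp only [hset]
  rw [integral_indicator_const _
    (Finset.measurableSet_biInter _ fun u _ => (hCm u).compl), smul_eq_mul, mul_comm,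
    measureReal_iInter_of_dependsOn N (fun u => (hCm u).compl) hD]
  · congr 1
    refine Finset.prod_congr rfl fun u _ => ?_
    rw [probReal_compl_eq_one_sub (hCm u)]
  · intro u huN w w' hww
    have h1 := hww u (hu u huN)
    have h2 : (w ∈ E u) = (w' ∈ E u) := hED u huN hww
    simp only [mem_compl_iff, mem_ofPred_eq, h1, h2]

/-! ### The recursion for selection probabilities -/

/-- The conditional probability, given that its weight is `x`, that a node of the `r`-regular tree
other than the root is selected by the recursion truncated at depth `n`. -/
def selectProb (ν : Measure ℝ) (r : ℕ) : ℕ → ℝ → ℝ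
  | 0, _ => 1
  | n + 1, x => (1 - ∫ y in Ioi x, selectProb ν r n y ∂ν) ^ (r - 1)

theorem integral_children {V : Type} [Fintype V] {ν : Measure ℝ} [IsProbabilityMeasure ν]
    {G : SimpleGraph V} {r n : ℕ} (hG : (2 * n + 3 : ℕ) ≤ G.egirth) {v : V} {N : Finset V}
    (hN : ∀ u ∈ N, G.Adj v u)
    (h : ∀ u ∈ N, ∀ {φ : ℝ → ℝ}, Integrable φ ν →
      ∫ w, {w : V → ℝ | Selects G w n v u}.indicator (fun w => φ (w u)) w
        ∂(Measure.pi (fun _ : V => ν)) = ∫ x, φ x * selectProb ν r n x ∂ν)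
    {φ : ℝ → ℝ} (hφ : Integrable φ ν) :
    ∫ w, {w : V → ℝ | ∀ u ∈ N, w v < w u → w ∉ {w | Selects G w n v u}}.indicator
        (fun w => φ (w v)) w ∂(Measure.pi (fun _ : V => ν)) =
      ∫ x, φ x * (1 - ∫ y in Ioi x, selectProb ν r n y ∂ν) ^ N.card ∂ν := by
  have hG2 : ((n + 2 : ℕ) : ℕ∞) ≤ G.egirth :=
    le_trans (by exact_mod_cast (by omega)) hG
  rw [integral_indicator_forall_not (ν := ν) v N
    (E := fun u => {w | Selects G w n v u}) (fun u => measurableSet_selects G n v u)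
    (D := fun u => branch G n v u)
    (fun a ha b hb hab => disjoint_branch hG (hN a ha) (hN b hb) hab)
    (fun u hu => dependsOn_selects n hG2 v u (hN u hu).symm)
    (fun u _ => notMem_branch G n v u)
    (fun u hu => mem_branch_self G n (hN u hu).ne) hφ]
  refine integral_congr_ae (Eventually.of_forall fun x => ?_)
  have hprob : ∀ u ∈ N, (Measure.pi (fun _ : V => ν)).real
      {w | x < w u ∧ w ∈ {w | Selects G w n v u}} = ∫ y in Ioi x, selectProb ν r n y ∂ν := by
    intro u hu
    -- Testing against the indicator of `Ioi x` turns the conditional statement into the probability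
    -- of being selected and heavier than `x`.
    have h := h u hu (φ := (Ioi x).indicator 1)
      ((integrable_const (1 : ℝ)).indicator measurableSet_Ioi)
    have hm : MeasurableSet {w : V → ℝ | x < w u ∧ w ∈ {w | Selects G w n v u}} :=
      (measurableSet_lt measurable_const (measurable_pi_apply u)).inter
        (measurableSet_selects G n v u)
    rw [← integral_indicator measurableSet_Ioi, ← integral_indicator_one hm]
    refine Eq.trans ?_ (h.trans (integral_congr_ae (Eventually.of_forall fun y => ?_)))
    · refine integral_congr_ae (Eventually.of_forall fun w => ?_)
      by_cases h1 : x < w u <;> by_cases h2 : Selects G w n v u <;> simp [indicator, h1, h2]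
    · by_cases hy : x < y <;> simp [indicator, hy]
  simp only
  rw [Finset.prod_congr rfl fun u hu => by rw [hprob u hu], Finset.prod_const]

/-- The arbitrary test function `φ` expresses conditioning on the weight of `v` without conditional
expectations. The girth grows by two per level because two branches of depth `n` must not meet. -/
theorem integral_selects {V : Type} [Fintype V] {ν : Measure ℝ} [IsProbabilityMeasure ν]
    {G : SimpleGraph V} {r : ℕ} (n : ℕ) (hreg : ∀ v, (G.neighborSet v).ncard = r)
    (hG : (2 * n + 1 : ℕ) ≤ G.egirth) :
    ∀ (p v : V), G.Adj v p → ∀ {φ : ℝ → ℝ}, Integrable φ ν →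
    ∫ w, {w : V → ℝ | Selects G w n p v}.indicator (fun w => φ (w v)) w
        ∂(Measure.pi (fun _ : V => ν)) = ∫ x, φ x * selectProb ν r n x ∂ν := by
  classical
  induction n with
  | zero =>
    intro p v _ φ hφ
    simpa [Selects, selectProb] using integral_eval v hφ.aestronglyMeasurable
  | succ n ih =>
    intro p v hp φ hφ
    set N := (G.neighborSet v \ {p}).toFinset with hN
    have hmem : ∀ u, u ∈ N ↔ G.Adj v u ∧ u ≠ p := by simp [hN]
    have hcard : N.card = r - 1 := by
      rw [hN, ← Set.ncard_eq_toFinset_card', Set.ncard_sdiff_singleton_of_mem (by simpa using hp),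
        hreg]
    have hset : {w : V → ℝ | Selects G w (n + 1) p v} =
        {w : V → ℝ | ∀ u ∈ N, w v < w u → w ∉ {w | Selects G w n v u}} := by
      ext w
      simp [Selects, hmem]
    rw [hset, integral_children hG (fun u hu => ((hmem u).mp hu).1)
      (fun u hu => ih (le_trans (by exact_mod_cast (by omega)) hG) v u ((hmem u).mp hu).1.symm) hφ,
      hcard]
    rfl

/-- The expected weight of the root of the `r`-regular tree, on the event that it is selected by
the recursion truncated at depth `n`. -/
def rootValue (ν : Measure ℝ) (r n : ℕ) : ℝ :=
  ∫ x, x * (1 - ∫ y in Ioi x, selectProb ν r n y ∂ν) ^ r ∂ν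

theorem measurableSet_rootSelects {V : Type} [Fintype V] (G : SimpleGraph V) (n : ℕ) (v : V) :
    MeasurableSet {w : V → ℝ | RootSelects G w n v} := by
  have : {w : V → ℝ | RootSelects G w n v} =
      ⋂ u, ⋂ (_ : G.Adj v u), ({w : V → ℝ | w v < w u} ∩ {w | Selects G w n v u})ᶜ := by
    ext w
    simp [RootSelects]
  rw [this]
  exact MeasurableSet.iInter fun u => MeasurableSet.iInter fun _ =>
    ((measurableSet_lt (measurable_pi_apply v) (measurable_pi_apply u)).inter
      (measurableSet_selects G n v u)).compl

/-- Without a parent, all `r` neighbours are children, whence the exponent `r` in place of `r - 1`.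
-/
theorem integral_rootSelects {V : Type} [Fintype V] {ν : Measure ℝ} [IsProbabilityMeasure ν]
    (hν : Integrable (fun x => x) ν) {G : SimpleGraph V} {r : ℕ} (n : ℕ)
    (hreg : ∀ v, (G.neighborSet v).ncard = r) (hG : (2 * n + 3 : ℕ) ≤ G.egirth) (v : V) :
    ∫ w, {w : V → ℝ | RootSelects G w n v}.indicator (fun w => w v) w
        ∂(Measure.pi (fun _ : V => ν)) = rootValue ν r n := by
  classical
  have hcard : (G.neighborSet v).toFinset.card = r := by
    rw [← Set.ncard_eq_toFinset_card', hreg]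
  have h := integral_children (r := r) hG (v := v) (N := (G.neighborSet v).toFinset)
    (by simp) (fun u hu => integral_selects n hreg
      (le_trans (by exact_mod_cast (by omega)) hG) v u ((by simpa using hu : G.Adj v u).symm)) hν
  rw [hcard] at h
  rw [rootValue, ← h]
  refine integral_congr_ae (Eventually.of_forall fun w => ?_)
  simp only [indicator, mem_ofPred_eq, RootSelects, Set.mem_toFinset, SimpleGraph.mem_neighborSet]
  congr

/-- On regular graphs of large girth, the expected ratio of GREEDY lies between consecutive
truncations of the recursion on the regular tree. -/
theorem integral_greedyRatio_mem_Icc {V : Type} [Fintype V] [Nonempty V] {ν : Measure ℝ}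
    [IsProbabilityMeasure ν] [NullSingletonClass ν] (hν : Integrable (fun x => x) ν)
    (hν0 : ∀ᵐ x ∂ν, 0 ≤ x) {G : SimpleGraph V} {r : ℕ} (m : ℕ)
    (hreg : ∀ v, (G.neighborSet v).ncard = r) (hG : (4 * m + 5 : ℕ) ≤ G.egirth) :
    ∫ w, greedyRatio G w ∂(Measure.pi (fun _ : V => ν)) ∈
      Icc (rootValue ν r (2 * m)) (rootValue ν r (2 * m + 1)) := by
  have hpos : ∀ v : V, ∀ᵐ w ∂(Measure.pi (fun _ : V => ν)), 0 ≤ w v := fun v =>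
    (measurePreserving_eval (fun _ : V => ν) v).quasiMeasurePreserving.ae hν0
  have hint : ∀ n (v : V), Integrable
      ({w : V → ℝ | RootSelects G w n v}.indicator (fun w => w v))
      (Measure.pi (fun _ : V => ν)) := fun n v =>
    (integrable_eval hν v).indicator (measurableSet_rootSelects G n v)
  have hlow : ∀ v : V, rootValue ν r (2 * m) ≤
      ∫ w, {w : V → ℝ | v ∈ greedy G w}.indicator (fun w => w v) w
        ∂(Measure.pi (fun _ : V => ν)) := by
    intro v
    rw [← integral_rootSelects hν (2 * m) hreg
      (le_trans (by exact_mod_cast (by omega)) hG) v]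
    refine integral_mono_ae (hint _ v) (integrable_indicator_greedy hν G v) ?_
    filter_upwards [hpos v, ae_injective_pi (V := V) (ν := ν)] with w hw hinj
    by_cases h : RootSelects G w (2 * m) v
    · rw [indicator_of_mem (show w ∈ {w | RootSelects G w (2 * m) v} from h),
        indicator_of_mem (show w ∈ {w | v ∈ greedy G w} from mem_greedy_of_rootSelects G hinj h)]
    · rw [indicator_of_notMem (show w ∉ {w | RootSelects G w (2 * m) v} from h)]
      exact indicator_apply_nonneg fun _ => hw
  have hupp : ∀ v : V, ∫ w, {w : V → ℝ | v ∈ greedy G w}.indicator (fun w => w v) w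
        ∂(Measure.pi (fun _ : V => ν)) ≤ rootValue ν r (2 * m + 1) := by
    intro v
    -- Depth `2 * m + 1` requires girth `2 * (2 * m + 1) + 3`, which is the assumed `4 * m + 5`.
    rw [← integral_rootSelects hν (2 * m + 1) hreg
      (le_trans (by exact_mod_cast (by omega)) hG) v]
    refine integral_mono_ae (integrable_indicator_greedy hν G v) (hint _ v) ?_
    filter_upwards [hpos v, ae_injective_pi (V := V) (ν := ν)] with w hw hinj
    by_cases h : v ∈ greedy G w
    · rw [indicator_of_mem (show w ∈ {w | v ∈ greedy G w} from h), indicator_of_mem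
        (show w ∈ {w | RootSelects G w (2 * m + 1) v} from rootSelects_of_mem_greedy G hinj h)]
    · rw [indicator_of_notMem (show w ∉ {w | v ∈ greedy G w} from h)]
      exact indicator_apply_nonneg fun _ => hw
  have hcard : (0 : ℝ) < Fintype.card V := by exact_mod_cast Fintype.card_pos
  rw [integral_greedyRatio hν, mem_Icc, le_div_iff₀ hcard, div_le_iff₀ hcard]
  constructor
  · simpa [mul_comm] using Finset.sum_le_sum fun v (_ : v ∈ Finset.univ) => hlow v
  · simpa [mul_comm] using Finset.sum_le_sum fun v (_ : v ∈ Finset.univ) => hupp v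

/-! ### Passage to quantiles -/

open ProbabilityTheory

theorem continuous_cdf (ν : Measure ℝ) [IsProbabilityMeasure ν] [NullSingletonClass ν] :
    Continuous (cdf ν) := by
  refine continuous_iff_continuousAt.mpr fun a => ?_
  have h1 : (cdf ν).measure {a} = 0 := by rw [measure_cdf]; exact measure_singleton a
  rw [StieltjesFunction.measure_singleton, ENNReal.ofReal_eq_zero] at h1
  refine continuousAt_iff_continuous_left'_right'.mpr ⟨?_, ?_⟩
  · rw [(monotone_cdf ν).continuousWithinAt_Iio_iff_leftLim_eq]
    exact le_antisymm ((monotone_cdf ν).leftLim_le le_rfl) (by linarith)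
  · exact ((cdf ν).right_continuous a).mono Ioi_subset_Ici_self

/-- The probability integral transform. -/
theorem map_cdf (ν : Measure ℝ) [IsProbabilityMeasure ν] [NullSingletonClass ν] :
    ν.map (cdf ν) = volume.restrict (Icc 0 1) := by
  have hcont := continuous_cdf ν
  have : IsFiniteMeasure (ν.map (cdf ν)) := Measure.isFiniteMeasure_map _ _
  refine Measure.ext_of_Iic _ _ fun t => ?_
  rw [Measure.map_apply hcont.measurable measurableSet_Iic, Measure.restrict_apply measurableSet_Iic]
  rcases lt_or_ge t 0 with ht0 | ht0
  · rw [show cdf ν ⁻¹' Iic t = ∅ from ?_, show Iic t ∩ Icc (0 : ℝ) 1 = ∅ from ?_]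
    · simp
    · ext x; simp only [mem_inter_iff, mem_Iic, mem_Icc, mem_empty_iff_false, iff_false]
      rintro ⟨h, h', _⟩; linarith
    · ext x; simp only [mem_preimage, mem_Iic, mem_empty_iff_false, iff_false, not_le]
      exact ht0.trans_le (cdf_nonneg ν x)
  rcases le_or_gt 1 t with ht1 | ht1
  · rw [show cdf ν ⁻¹' Iic t = univ from ?_, show Iic t ∩ Icc (0 : ℝ) 1 = Icc 0 1 from ?_]
    · simp
    · exact inter_eq_right.mpr fun x hx => hx.2.trans ht1
    · exact eq_univ_of_forall fun x => (cdf_le_one ν x).trans ht1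
  rw [show Iic t ∩ Icc (0 : ℝ) 1 = Icc 0 t from ?_, Real.volume_Icc, sub_zero]
  swap
  · ext x; simp only [mem_inter_iff, mem_Iic, mem_Icc]
    constructor
    · rintro ⟨h, h', _⟩; exact ⟨h', h⟩
    · rintro ⟨h, h'⟩; exact ⟨h', h, by linarith⟩
  rcases (cdf ν ⁻¹' Iic t).eq_empty_or_nonempty with he | hne
  -- If `cdf ν` exceeds `t` everywhere, its limit 0 at `-∞` forces `t = 0`.
  · have : t ≤ 0 := by
      refine ge_of_tendsto (tendsto_cdf_atBot ν) (Eventually.of_forall fun x => ?_)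
      by_contra! h
      exact (he ▸ (show x ∈ cdf ν ⁻¹' Iic t from h.le) : x ∈ (∅ : Set ℝ))
    rw [he, le_antisymm this ht0]
    simp
  · have hbdd : BddAbove (cdf ν ⁻¹' Iic t) := by
      obtain ⟨b, hb⟩ := ((tendsto_cdf_atTop ν).eventually (lt_mem_nhds ht1)).exists
      refine ⟨b, fun x hx => ?_⟩
      by_contra! h
      exact absurd (hb.trans_le (monotone_cdf ν h.le)) (not_lt.mpr hx)
    set s := sSup (cdf ν ⁻¹' Iic t)
    have hs : s ∈ cdf ν ⁻¹' Iic t := (isClosed_Iic.preimage hcont).csSup_mem hne hbdd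
    have heq : cdf ν ⁻¹' Iic t = Iic s :=
      Subset.antisymm (fun x hx => le_csSup hbdd hx)
        (fun x hx => (monotone_cdf ν hx).trans hs)
    -- Beyond `s` the distribution function exceeds `t`; continuity at `s` gives equality.
    have hst : cdf ν s = t := by
      refine le_antisymm hs ?_
      refine ge_of_tendsto (hcont.continuousWithinAt (s := Ioi s) (x := s)) ?_
      filter_upwards [self_mem_nhdsWithin] with y hy
      by_contra! h
      exact absurd (le_csSup hbdd (show y ∈ cdf ν ⁻¹' Iic t from h.le)) (not_le.mpr hy)
    rw [heq, ← hst, ofReal_cdf]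

/-- The distribution function may have flat pieces, so `Ioi x` can differ from the set where it
exceeds `cdf ν x`; the difference lies in a level set, which is null since the uniform law has no
atoms. -/
theorem setIntegral_comp_cdf (ν : Measure ℝ) [IsProbabilityMeasure ν] [NullSingletonClass ν]
    {g : ℝ → ℝ} (hg : Measurable g) (x : ℝ) :
    ∫ y in Ioi x, g (cdf ν y) ∂ν = ∫ t in cdf ν x..1, g t := by
  have hcont := continuous_cdf ν
  have hnull : ν (cdf ν ⁻¹' {cdf ν x}) = 0 := by
    rw [← Measure.map_apply hcont.measurable (measurableSet_singleton _), map_cdf]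
    exact Measure.restrict_apply_eq_zero (measurableSet_singleton _) |>.mpr
      (measure_mono_null inter_subset_left (measure_singleton _))
  have hae : Ioi x =ᵐ[ν] cdf ν ⁻¹' Ioi (cdf ν x) := by
    have : ∀ᵐ y ∂ν, y ∉ cdf ν ⁻¹' {cdf ν x} := measure_eq_zero_iff_ae_notMem.mp hnull
    filter_upwards [this] with y hy
    refine propext ⟨fun h => ?_, fun h => ?_⟩
    · exact lt_of_le_of_ne (monotone_cdf ν (le_of_lt h)) (fun h' => hy h'.symm)
    · by_contra h'
      exact absurd (monotone_cdf ν (not_lt.mp h')) (not_le.mpr h)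
  rw [setIntegral_congr_set hae, ← setIntegral_map measurableSet_Ioi hg.aestronglyMeasurable
    hcont.measurable.aemeasurable, map_cdf, Measure.restrict_restrict measurableSet_Ioi,
    intervalIntegral.integral_of_le (cdf_le_one ν x)]
  congr 2
  ext y
  simp only [mem_inter_iff, mem_Ioi, mem_Icc, mem_Ioc]
  have := cdf_nonneg ν x
  constructor
  · rintro ⟨h, _, h'⟩; exact ⟨h, h'⟩
  · rintro ⟨h, h'⟩; exact ⟨h, by linarith, h'⟩

/-! ### Picard iteration and its explicit limit -/

/-- The selection probabilities in terms of the quantile of the weight. -/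
def quantileProb (r : ℕ) : ℕ → ℝ → ℝ
  | 0, _ => 1
  | n + 1, u => (1 - ∫ t in u..1, quantileProb r n t) ^ (r - 1)

theorem continuous_quantileProb (r n : ℕ) : Continuous (quantileProb r n) := by
  induction n with
  | zero => exact continuous_const
  | succ n ih =>
    have : quantileProb r (n + 1) = fun u => (1 + ∫ t in (1 : ℝ)..u, quantileProb r n t) ^ (r - 1) := by
      ext u
      rw [quantileProb, intervalIntegral.integral_symm, sub_neg_eq_add]
    rw [this]
    exact (continuous_const.add (intervalIntegral.continuous_primitive
      (fun a b => ih.intervalIntegrable a b) 1)).pow _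

theorem selectProb_eq_quantileProb (ν : Measure ℝ) [IsProbabilityMeasure ν]
    [NullSingletonClass ν] (r n : ℕ) (x : ℝ) :
    selectProb ν r n x = quantileProb r n (cdf ν x) := by
  induction n generalizing x with
  | zero => rfl
  | succ n ih =>
    rw [selectProb, quantileProb, ← setIntegral_comp_cdf ν (continuous_quantileProb r n).measurable]
    simp_rw [ih]

theorem integral_quantileProb_mem_Icc {r n : ℕ} {u : ℝ} (hu : u ∈ Icc (0 : ℝ) 1)
    (h : ∀ t ∈ Icc (0 : ℝ) 1, quantileProb r n t ∈ Icc (0 : ℝ) 1) :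
    1 - ∫ t in u..1, quantileProb r n t ∈ Icc (0 : ℝ) 1 := by
  have hsub : ∀ t ∈ Icc u 1, t ∈ Icc (0 : ℝ) 1 := fun t ht => ⟨hu.1.trans ht.1, ht.2⟩
  have h0 : 0 ≤ ∫ t in u..1, quantileProb r n t :=
    intervalIntegral.integral_nonneg hu.2 fun t ht => (h t (hsub t ht)).1
  have h1 : ∫ t in u..1, quantileProb r n t ≤ ∫ _t in u..1, (1 : ℝ) :=
    intervalIntegral.integral_mono_on hu.2
      ((continuous_quantileProb r n).intervalIntegrable _ _) (by simp)
      fun t ht => (h t (hsub t ht)).2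
  rw [intervalIntegral.integral_const, smul_eq_mul, mul_one] at h1
  exact ⟨by linarith [hu.1], by linarith⟩

theorem quantileProb_mem_Icc (r n : ℕ) {u : ℝ} (hu : u ∈ Icc (0 : ℝ) 1) :
    quantileProb r n u ∈ Icc (0 : ℝ) 1 := by
  induction n generalizing u with
  | zero => simp [quantileProb]
  | succ n ih =>
    have h := integral_quantileProb_mem_Icc hu fun t ht => ih ht
    exact ⟨pow_nonneg h.1 _, pow_le_one₀ h.1 h.2⟩

/-- The limiting probability that none of the heavier children of a node with weight quantile `u`
is selected, per child slot. -/
def limitProb (r : ℕ) (u : ℝ) : ℝ :=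
  ((r : ℝ) - 1 - ((r : ℝ) - 2) * u) ^ (-(1 / ((r : ℝ) - 2)))

theorem one_le_base {r : ℕ} (hr : 3 ≤ r) {u : ℝ} (hu : u ≤ 1) :
    1 ≤ (r : ℝ) - 1 - ((r : ℝ) - 2) * u := by
  have : (3 : ℝ) ≤ r := by exact_mod_cast hr
  nlinarith

theorem limitProb_mem_Icc {r : ℕ} (hr : 3 ≤ r) {u : ℝ} (hu : u ≤ 1) :
    limitProb r u ∈ Icc (0 : ℝ) 1 := by
  have hb := one_le_base hr hu
  have : (3 : ℝ) ≤ r := by exact_mod_cast hr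
  refine ⟨Real.rpow_nonneg (by linarith) _, Real.rpow_le_one_of_one_le_of_nonpos hb ?_⟩
  rw [neg_nonpos]
  exact div_nonneg zero_le_one (by linarith)

theorem limitProb_pow {r : ℕ} (hr : 3 ≤ r) {u : ℝ} (hu : u ≤ 1) (k : ℕ) :
    limitProb r u ^ k =
      ((r : ℝ) - 1 - ((r : ℝ) - 2) * u) ^ (-((k : ℝ) / ((r : ℝ) - 2))) := by
  have hb := one_le_base hr hu
  rw [limitProb, ← Real.rpow_natCast, ← Real.rpow_mul (by linarith)]
  congr 1
  ring

/-- This is the differential form of the fixed-point equation of the quantile recursion. -/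
theorem hasDerivAt_limitProb {r : ℕ} (hr : 3 ≤ r) {u : ℝ} (hu : u ≤ 1) :
    HasDerivAt (limitProb r) (limitProb r u ^ (r - 1)) u := by
  have hb := one_le_base hr hu
  have hr' : (3 : ℝ) ≤ r := by exact_mod_cast hr
  have h1 : HasDerivAt (fun u : ℝ => (r : ℝ) - 1 - ((r : ℝ) - 2) * u) (-((r : ℝ) - 2)) u := by
    simpa using ((hasDerivAt_id u).const_mul ((r : ℝ) - 2)).const_sub ((r : ℝ) - 1)
  have h2 := h1.rpow_const (p := -(1 / ((r : ℝ) - 2))) (Or.inl (by positivity))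
  refine h2.congr_deriv ?_
  have hne : (r : ℝ) - 2 ≠ 0 := by linarith
  rw [limitProb_pow hr hu, Nat.cast_sub (by omega : 1 ≤ r)]
  rw [show -(1 / ((r : ℝ) - 2)) - 1 = -(((r : ℝ) - (1 : ℕ)) / ((r : ℝ) - 2)) by
    push_cast; field_simp; ring]
  field_simp

theorem continuousOn_limitProb {r : ℕ} (hr : 3 ≤ r) : ContinuousOn (limitProb r) (Iic 1) :=
  fun _ hu => (hasDerivAt_limitProb hr hu).continuousAt.continuousWithinAt

theorem intervalIntegrable_limitProb_pow {r : ℕ} (hr : 3 ≤ r) {u : ℝ} (hu : u ≤ 1) (k : ℕ) :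
    IntervalIntegrable (fun t => limitProb r t ^ k) volume u 1 :=
  (((continuousOn_limitProb hr).pow k).mono fun t ht => by
    rw [uIcc_of_le hu] at ht; exact ht.2).intervalIntegrable

theorem integral_limitProb_pow {r : ℕ} (hr : 3 ≤ r) {u : ℝ} (hu : u ≤ 1) :
    ∫ t in u..1, limitProb r t ^ (r - 1) = 1 - limitProb r u := by
  rw [intervalIntegral.integral_eq_sub_of_hasDerivAt (f := limitProb r)
    (fun t ht => hasDerivAt_limitProb hr (by rw [uIcc_of_le hu] at ht; exact ht.2))
    (intervalIntegrable_limitProb_pow hr hu _)]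
  congr 1
  simp only [limitProb, mul_one]
  rw [show (r : ℝ) - 1 - ((r : ℝ) - 2) = 1 by ring, Real.one_rpow]

/-- `limitProb` is a fixed point, so only the error is integrated; integrating `(1 - t) ^ n` from
`u` to 1 produces the divisor `n + 1`, and hence the factorial later. -/
theorem abs_integral_quantileProb_sub_le {r n : ℕ} (hr : 3 ≤ r) {c : ℝ}
    (h : ∀ t ∈ Icc (0 : ℝ) 1, |quantileProb r n t - limitProb r t ^ (r - 1)| ≤ c * (1 - t) ^ n)
    {u : ℝ} (hu : u ∈ Icc (0 : ℝ) 1) :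
    |(1 - ∫ t in u..1, quantileProb r n t) - limitProb r u| ≤
      c / (n + 1 : ℕ) * (1 - u) ^ (n + 1) := by
  have hi := (continuous_quantileProb r n).intervalIntegrable (μ := volume) u 1
  have hi' := intervalIntegrable_limitProb_pow hr hu.2 (r - 1)
  have heq : (1 - ∫ t in u..1, quantileProb r n t) - limitProb r u =
      -∫ t in u..1, (quantileProb r n t - limitProb r t ^ (r - 1)) := by
    rw [intervalIntegral.integral_sub hi hi', integral_limitProb_pow hr hu.2]
    ring
  rw [heq, abs_neg]
  refine (intervalIntegral.abs_integral_le_integral_abs hu.2).trans ?_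
  have hc : Continuous fun t : ℝ => c * (1 - t) ^ n := by fun_prop
  refine (intervalIntegral.integral_mono_on hu.2 (hi.sub hi').abs
    (hc.intervalIntegrable _ _) fun t ht => h t ⟨hu.1.trans ht.1, ht.2⟩).trans_eq ?_
  rw [intervalIntegral.integral_const_mul,
    intervalIntegral.integral_comp_sub_left (fun t : ℝ => t ^ n) 1, integral_pow]
  simp
  ring

theorem abs_one_sub_integral_quantileProb_sub_le {r : ℕ} (hr : 3 ≤ r) (n : ℕ) {u : ℝ}
    (hu : u ∈ Icc (0 : ℝ) 1) :
    |(1 - ∫ t in u..1, quantileProb r n t) - limitProb r u| ≤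
      ((r - 1 : ℕ) : ℝ) ^ n / (n + 1).factorial * (1 - u) ^ (n + 1) := by
  induction n generalizing u with
  | zero =>
    have h := abs_integral_quantileProb_sub_le (n := 0) hr (c := 1) ?_ hu
    · simpa using h
    · intro t ht
      have h := limitProb_mem_Icc hr ht.2
      have h0 : 0 ≤ limitProb r t ^ (r - 1) := pow_nonneg h.1 _
      have h1 : limitProb r t ^ (r - 1) ≤ 1 := pow_le_one₀ h.1 h.2
      simp only [quantileProb, pow_zero, mul_one, abs_le]
      constructor <;> linarith
  | succ n ih =>
    have h := abs_integral_quantileProb_sub_le (n := n + 1) hr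
      (c := ((r - 1 : ℕ) : ℝ) ^ (n + 1) / (n + 1).factorial) ?_ hu
    · refine h.trans_eq ?_
      rw [Nat.factorial_succ (n + 1)]
      push_cast
      field_simp
    · intro t ht
      have hq := integral_quantileProb_mem_Icc ht fun s hs => quantileProb_mem_Icc r n hs
      have hl := limitProb_mem_Icc hr ht.2
      rw [quantileProb]
      -- On [0,1] the power `r - 1` is Lipschitz with constant `r - 1`, which is the new factor in
      -- `c`.
      refine (abs_pow_sub_pow_le _ _ _).trans ?_
      have hmax : max |1 - ∫ t in t..1, quantileProb r n t| |limitProb r t| ^ (r - 1 - 1) ≤ 1 := by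
        refine pow_le_one₀ (le_max_of_le_left (abs_nonneg _)) (max_le ?_ ?_)
        · rw [abs_of_nonneg hq.1]; exact hq.2
        · rw [abs_of_nonneg hl.1]; exact hl.2
      refine (mul_le_of_le_one_right (by positivity) hmax).trans ?_
      refine (mul_le_mul_of_nonneg_right (ih ht) (by positivity)).trans_eq ?_
      ring

theorem tendsto_one_sub_integral_quantileProb {r : ℕ} (hr : 3 ≤ r) {u : ℝ}
    (hu : u ∈ Icc (0 : ℝ) 1) :
    Tendsto (fun n => 1 - ∫ t in u..1, quantileProb r n t) atTop (𝓝 (limitProb r u)) := by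
  rw [tendsto_iff_norm_sub_tendsto_zero]
  refine squeeze_zero (fun _ => norm_nonneg _) (fun n => ?_)
    (FloorSemiring.tendsto_pow_div_factorial_atTop ((r - 1 : ℕ) : ℝ))
  rw [Real.norm_eq_abs]
  refine (abs_one_sub_integral_quantileProb_sub_le hr n hu).trans ?_
  have h1 : (1 - u) ^ (n + 1) ≤ 1 := pow_le_one₀ (by linarith [hu.2]) (by linarith [hu.1])
  refine (mul_le_of_le_one_right (by positivity) h1).trans ?_
  gcongr
  exact Nat.le_succ n

theorem tendsto_rootValue {ν : Measure ℝ} [IsProbabilityMeasure ν] [NullSingletonClass ν]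
    (hν : Integrable (fun x => x) ν) {r : ℕ} (hr : 3 ≤ r) :
    Tendsto (rootValue ν r) atTop (𝓝 (∫ x, x * limitProb r (cdf ν x) ^ r ∂ν)) := by
  have hmem : ∀ x, cdf ν x ∈ Icc (0 : ℝ) 1 := fun x => ⟨cdf_nonneg ν x, cdf_le_one ν x⟩
  have heq : ∀ n x, ∫ y in Ioi x, selectProb ν r n y ∂ν =
      ∫ t in cdf ν x..1, quantileProb r n t := by
    intro n x
    simp_rw [selectProb_eq_quantileProb]
    exact setIntegral_comp_cdf ν (continuous_quantileProb r n).measurable x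
  unfold rootValue
  simp only [heq]
  refine tendsto_integral_of_dominated_convergence (fun x => |x|) (fun n => ?_) hν.abs ?_ ?_
  · have : Continuous fun u : ℝ => ∫ t in u..1, quantileProb r n t := by
      have h := (intervalIntegral.continuous_primitive (fun a b =>
        (continuous_quantileProb r n).intervalIntegrable (μ := volume) a b) 1).neg
      refine h.congr fun u => ?_
      rw [intervalIntegral.integral_symm]
      simp
    exact (continuous_id.mul ((continuous_const.sub
      (this.comp (continuous_cdf ν))).pow r)).aestronglyMeasurable
  · refine fun n => Eventually.of_forall fun x => ?_
    have h := integral_quantileProb_mem_Icc (hmem x) fun t ht => quantileProb_mem_Icc r n ht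
    rw [norm_mul, Real.norm_eq_abs, Real.norm_eq_abs, abs_of_nonneg (pow_nonneg h.1 r)]
    exact mul_le_of_le_one_right (abs_nonneg x) (pow_le_one₀ h.1 h.2)
  · refine Eventually.of_forall fun x => ?_
    exact ((tendsto_one_sub_integral_quantileProb hr (hmem x)).pow r).const_mul x

/-- Counting with `ncard` keeps decidability instances out of the degree condition. -/
theorem isRegularOfGirthGE_iff {V : Type} [Fintype V] {g r : ℕ} {G : SimpleGraph V} :
    IsRegularOfGirthGE g r G ↔
      (∀ v, (G.neighborSet v).ncard = r) ∧ (g : ℕ∞) ≤ G.egirth := by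
  classical
  unfold IsRegularOfGirthGE SimpleGraph.IsRegularOfDegree
  refine and_congr_left fun _ => forall_congr' fun v => ?_
  rw [← SimpleGraph.card_neighborSet_eq_degree, Set.ncard_eq_toFinset_card', Set.toFinset_card]

/-! ### Regular graphs of arbitrarily large girth -/

/-- The words of length at most `N` over `r` letters without two equal consecutive letters: the
ball of radius `N` in the `r`-regular tree. -/
abbrev ReducedWord (r N : ℕ) : Type :=
  {l : List (Fin r) // l.length ≤ N ∧ l.IsChain (· ≠ ·)}

instance (r N : ℕ) : Finite (ReducedWord r N) :=
  ((List.finite_length_le (Fin r) N).subset fun _ h => h.1).to_subtype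

/-- Follow the edge of colour `i` in the ball of the regular tree, if there is one. -/
def flipLetter {r N : ℕ} (i : Fin r) (l : ReducedWord r N) : ReducedWord r N :=
  if l.1.head? = some i then
    ⟨l.1.tail, l.1.length_tail ▸ (Nat.sub_le _ _).trans l.2.1, l.2.2.tail⟩
  else if h : l.1.length < N ∧ (i :: l.1).IsChain (· ≠ ·) then ⟨i :: l.1, h⟩ else l

theorem flipLetter_of_head?_ne {r N : ℕ} {i : Fin r} {l : ReducedWord r N}
    (hi : l.1.head? ≠ some i) (hl : l.1.length < N) : (flipLetter i l).1 = i :: l.1 := by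
  have hc : (i :: l.1).IsChain (· ≠ ·) := by
    rw [List.isChain_cons]
    refine ⟨fun j hj hij => hi ?_, l.2.2⟩
    rw [hij]
    exact hj
  rw [flipLetter, if_neg hi, dif_pos ⟨hl, hc⟩]

theorem flipLetter_of_length_eq {r N : ℕ} {i : Fin r} {l : ReducedWord r N}
    (hi : l.1.head? ≠ some i) (hl : ¬ l.1.length < N) : flipLetter i l = l := by
  rw [flipLetter, if_neg hi, dif_neg fun h => hl h.1]

theorem flipLetter_involutive {r N : ℕ} (i : Fin r) :
    Function.Involutive (flipLetter (N := N) i) := by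
  rintro ⟨l, hl, hc⟩
  by_cases hi : l.head? = some i
  · obtain ⟨l', rfl⟩ : ∃ l', l = i :: l' := by
      cases l with
      | nil => simp at hi
      | cons a l' => exact ⟨l', by simpa using hi⟩
    have h1 : flipLetter i (⟨i :: l', hl, hc⟩ : ReducedWord r N) =
        ⟨l', (Nat.le_succ _).trans hl, hc.tail⟩ := by
      rw [flipLetter, if_pos (by simp)]
      rfl
    have hne : l'.head? ≠ some i := fun h =>
      (List.isChain_cons.mp hc).1 i h rfl
    rw [h1]
    exact Subtype.ext (flipLetter_of_head?_ne hne (by simpa using hl))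
  · by_cases hlt : l.length < N
    · have h1 := flipLetter_of_head?_ne (l := (⟨l, hl, hc⟩ : ReducedWord r N)) hi hlt
      apply Subtype.ext
      rw [flipLetter, if_pos (by rw [h1]; rfl)]
      simp [h1]
    · have h1 := flipLetter_of_length_eq (l := (⟨l, hl, hc⟩ : ReducedWord r N)) hi hlt
      rw [h1, h1]

/-- The involution of the ball of the regular tree given by the edges of colour `i`. -/
def letterPerm (r N : ℕ) (i : Fin r) : Equiv.Perm (ReducedWord r N) :=
  (flipLetter_involutive i).toPerm

theorem letterPerm_mul_self (r N : ℕ) (i : Fin r) : letterPerm r N i * letterPerm r N i = 1 :=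
  Equiv.ext fun l => flipLetter_involutive i l

/-- The empty word. -/
def emptyWord (r N : ℕ) : ReducedWord r N := ⟨[], by simp⟩

theorem letterPerm_emptyWord {r N : ℕ} (hN : 0 < N) (i : Fin r) :
    (letterPerm r N i (emptyWord r N)).1 = [i] :=
  flipLetter_of_head?_ne (l := emptyWord r N) (by simp [emptyWord]) (by simpa [emptyWord] using hN)

theorem letterPerm_injective {r N : ℕ} (hN : 0 < N) : Function.Injective (letterPerm r N) := by
  intro i j h
  have h1 := letterPerm_emptyWord hN i
  rw [h, letterPerm_emptyWord hN j] at h1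
  simpa using h1.symm

theorem letterPerm_ne_one {r N : ℕ} (hN : 0 < N) (i : Fin r) : letterPerm r N i ≠ 1 := by
  intro h
  have h1 := letterPerm_emptyWord hN i
  rw [h] at h1
  simp [emptyWord] at h1

/-- The Cayley graph of the permutations of the ball of radius `N` in the `r`-regular tree with
respect to the involutions given by the edge colours. -/
def largeGirthGraph (r N : ℕ) : SimpleGraph (Equiv.Perm (ReducedWord r N)) where
  Adj a b := a ≠ b ∧ ∃ i, b = letterPerm r N i * a
  symm := ⟨by
    rintro a _ ⟨hne, i, rfl⟩
    exact ⟨hne.symm, i, by rw [← mul_assoc, letterPerm_mul_self, one_mul]⟩⟩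
  loopless := ⟨fun a h => h.1 rfl⟩

theorem ncard_neighborSet_largeGirthGraph {r N : ℕ} (hN : 0 < N)
    (a : Equiv.Perm (ReducedWord r N)) : ((largeGirthGraph r N).neighborSet a).ncard = r := by
  have : (largeGirthGraph r N).neighborSet a = range fun i => letterPerm r N i * a := by
    ext b
    simp only [SimpleGraph.mem_neighborSet, largeGirthGraph, mem_range]
    constructor
    · rintro ⟨_, i, rfl⟩
      exact ⟨i, rfl⟩
    · rintro ⟨i, rfl⟩
      exact ⟨fun h => letterPerm_ne_one hN i (mul_eq_right.mp h.symm), i, rfl⟩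
  rw [this, ← image_univ, ncard_image_of_injective _
    (fun i j h => letterPerm_injective hN (mul_right_cancel h)), ncard_univ, Nat.card_fin]

/-- Every edge of the walk applies a generator. A trail never goes straight back along an edge, so
no letter is cancelled and, inside the ball, each step prepends one. -/
theorem length_apply_of_isTrail {r N : ℕ} {a b : Equiv.Perm (ReducedWord r N)}
    (p : (largeGirthGraph r N).Walk a b) (hp : p.IsTrail) (l : ReducedWord r N)
    (hl : l.1.length + p.length ≤ N)
    (hhead : ∀ i, l.1.head? = some i → s(a, letterPerm r N i * a) ∉ p.edges) :
    ((b * a⁻¹) l).1.length = l.1.length + p.length := by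
  induction p generalizing l with
  | nil => simp
  | @cons a c b h q ih =>
    obtain ⟨_, i, rfl⟩ := id h
    rw [SimpleGraph.Walk.isTrail_cons] at hp
    rw [SimpleGraph.Walk.length_cons] at hl ⊢
    have hi : l.1.head? ≠ some i := fun hi => hhead i hi (by simp)
    have h1 : (letterPerm r N i l).1 = i :: l.1 := flipLetter_of_head?_ne hi (by omega)
    -- The new head letter is `i`, and the edge of that colour at the new vertex is the one just
    -- traversed.
    have h2 := ih hp.1 (letterPerm r N i l) (by rw [h1, List.length_cons]; omega) (by
      intro j hj
      rw [h1] at hj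
      obtain rfl : i = j := by simpa using hj
      rw [← mul_assoc, letterPerm_mul_self, one_mul, Sym2.eq_swap]
      exact hp.2)
    rw [h1, List.length_cons] at h2
    have h3 : (b * a⁻¹) l = (b * (letterPerm r N i * a)⁻¹) (letterPerm r N i l) := by
      rw [← Equiv.Perm.mul_apply]
      congr 1
      group
    rw [h3, h2]
    omega

/-- A closed walk acts as the identity, whereas a cycle shorter than `N` would lengthen the empty
word. -/
theorem le_egirth_largeGirthGraph (r N : ℕ) : (N : ℕ∞) ≤ (largeGirthGraph r N).egirth := by
  rw [SimpleGraph.le_egirth]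
  intro a p hp
  by_contra! h
  have hlt : p.length < N := by exact_mod_cast h
  have h1 := length_apply_of_isTrail p hp.isTrail (emptyWord r N)
    (by simpa [emptyWord] using hlt.le) (by simp [emptyWord])
  have h2 := hp.three_le_length
  simp [emptyWord] at h1
  omega

theorem exists_isRegularOfGirthGE (g r : ℕ) :
    ∃ (V : Type) (_ : Fintype V) (_ : Nonempty V) (G : SimpleGraph V),
      IsRegularOfGirthGE g r G :=
  -- Radius `g + 1` stays positive at `g = 0`, as needed for distinct nontrivial generators.
  ⟨Equiv.Perm (ReducedWord r (g + 1)), Fintype.ofFinite _, ⟨1⟩, largeGirthGraph r (g + 1),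
    @isRegularOfGirthGE_iff _ (Fintype.ofFinite _) _ _ _ |>.mpr
      ⟨ncard_neighborSet_largeGirthGraph g.succ_pos,
        le_trans (by exact_mod_cast g.le_succ) (le_egirth_largeGirthGraph r (g + 1))⟩⟩

/-! ### Bounds over the whole family and the two limits -/

/-- This crude bound needs no girth assumption, so the infima and suprema are meaningful for every
`g`. -/
theorem abs_integral_greedyRatio_le {V : Type} [Fintype V] [Nonempty V] {ν : Measure ℝ}
    [IsProbabilityMeasure ν] (hν : Integrable (fun x => x) ν) (G : SimpleGraph V) :
    |∫ w, greedyRatio G w ∂(Measure.pi (fun _ : V => ν))| ≤ ∫ x, |x| ∂ν := by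
  have hcard : (0 : ℝ) < Fintype.card V := by exact_mod_cast Fintype.card_pos
  rw [integral_greedyRatio hν, abs_div, abs_of_pos hcard, div_le_iff₀ hcard]
  refine (Finset.abs_sum_le_sum_abs _ _).trans ?_
  have h : ∀ v : V, |∫ w, {w : V → ℝ | v ∈ greedy G w}.indicator (fun w => w v) w
      ∂(Measure.pi (fun _ : V => ν))| ≤ ∫ x, |x| ∂ν := by
    intro v
    rw [← integral_eval (V := V) v hν.abs.aestronglyMeasurable]
    refine abs_integral_le_integral_abs.trans
      (integral_mono (integrable_indicator_greedy hν G v).abs (integrable_eval hν v).abs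
        fun w => ?_)
    rw [← Real.norm_eq_abs]
    exact norm_indicator_le_norm_self _ _
  simpa [mul_comm] using Finset.sum_le_sum fun v (_ : v ∈ Finset.univ) => h v

theorem expectedRatios_nonempty (ν : Measure ℝ) (g r : ℕ) : (expectedRatios ν g r).Nonempty := by
  obtain ⟨V, h1, h2, G, hG⟩ := exists_isRegularOfGirthGE g r
  exact ⟨_, V, h1, h2, G, hG, rfl⟩

theorem expectedRatios_subset_Icc {ν : Measure ℝ} [IsProbabilityMeasure ν]
    (hν : Integrable (fun x => x) ν) (g r : ℕ) :
    expectedRatios ν g r ⊆ Icc (-∫ x, |x| ∂ν) (∫ x, |x| ∂ν) := by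
  rintro _ ⟨V, h1, h2, G, _, rfl⟩
  exact abs_le.mp (abs_integral_greedyRatio_le hν G)

theorem expectedRatios_subset_Icc_rootValue {ν : Measure ℝ} [IsProbabilityMeasure ν]
    [NullSingletonClass ν] (hν : Integrable (fun x => x) ν) (hν0 : ∀ᵐ x ∂ν, 0 ≤ x) {g m r : ℕ}
    (hg : 4 * m + 5 ≤ g) :
    expectedRatios ν g r ⊆ Icc (rootValue ν r (2 * m)) (rootValue ν r (2 * m + 1)) := by
  rintro _ ⟨V, h1, h2, G, hG, rfl⟩
  obtain ⟨hreg, hgirth⟩ := isRegularOfGirthGE_iff.mp hG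
  exact integral_greedyRatio_mem_Icc hν hν0 m hreg (le_trans (by exact_mod_cast hg) hgirth)

/-- A sequence which is eventually in each of a family of intervals shrinking to `L` tends to
`L`. -/
theorem tendsto_of_mem_Icc_eventually {x a b : ℕ → ℝ} {L : ℝ} (ha : Tendsto a atTop (𝓝 L))
    (hb : Tendsto b atTop (𝓝 L)) (h : ∀ m, ∀ᶠ g in atTop, x g ∈ Icc (a m) (b m)) :
    Tendsto x atTop (𝓝 L) := by
  rw [tendsto_order]
  constructor
  · intro c hc
    obtain ⟨m, hm⟩ := (ha.eventually (lt_mem_nhds hc)).exists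
    exact (h m).mono fun g hg => hm.trans_le hg.1
  · intro c hc
    obtain ⟨m, hm⟩ := (hb.eventually (gt_mem_nhds hc)).exists
    exact (h m).mono fun g hg => hg.2.trans_lt hm

theorem tendsto_sInf_sSup_expectedRatios {ν : Measure ℝ} [IsProbabilityMeasure ν]
    [NullSingletonClass ν] (hν : Integrable (fun x => x) ν) (hν0 : ∀ᵐ x ∂ν, 0 ≤ x) {r : ℕ}
    (hr : 3 ≤ r) :
    Tendsto (fun g : ℕ => sInf (expectedRatios ν g r)) atTop
      (𝓝 (∫ x, x * limitProb r (cdf ν x) ^ r ∂ν)) ∧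
    Tendsto (fun g : ℕ => sSup (expectedRatios ν g r)) atTop
      (𝓝 (∫ x, x * limitProb r (cdf ν x) ^ r ∂ν)) := by
  have hroot := tendsto_rootValue hν hr
  have ha : Tendsto (fun m => rootValue ν r (2 * m)) atTop _ :=
    hroot.comp (tendsto_atTop_mono (fun m => by simp only [id]; omega) tendsto_id)
  have hb : Tendsto (fun m => rootValue ν r (2 * m + 1)) atTop _ :=
    hroot.comp (tendsto_atTop_mono (fun m => by simp only [id]; omega) tendsto_id)
  have key : ∀ m, ∀ᶠ g in atTop, expectedRatios ν g r ⊆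
      Icc (rootValue ν r (2 * m)) (rootValue ν r (2 * m + 1)) := fun m =>
    (eventually_ge_atTop (4 * m + 5)).mono fun g hg =>
      expectedRatios_subset_Icc_rootValue hν hν0 hg
  have hbdd := fun g => expectedRatios_subset_Icc hν g r
  constructor
  · refine tendsto_of_mem_Icc_eventually ha hb fun m => (key m).mono fun g hg => ?_
    obtain ⟨x, hx⟩ := expectedRatios_nonempty ν g r
    exact ⟨le_csInf ⟨x, hx⟩ fun y hy => (hg hy).1,
      (csInf_le (bddBelow_Icc.mono (hbdd g)) hx).trans (hg hx).2⟩
  · refine tendsto_of_mem_Icc_eventually ha hb fun m => (key m).mono fun g hg => ?_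
    obtain ⟨x, hx⟩ := expectedRatios_nonempty ν g r
    exact ⟨(hg hx).1.trans (le_csSup (bddAbove_Icc.mono (hbdd g)) hx),
      csSup_le ⟨x, hx⟩ fun y hy => (hg hy).2⟩

end GreedyMWIS

end

theorem mainTheorem10 {Ω : Type*} [MeasurableSpace Ω] (P : Measure Ω) [IsProbabilityMeasure P]
    (r : ℕ) (hr : 3 ≤ r)
    (W : Ω → ℝ) (hW : Measurable W) (hW_nonneg : ∀ᵐ ω ∂P, 0 ≤ W ω) (hW_int : Integrable W P)
    (F : ℝ → ℝ) (hF : ∀ t, F t = P.real {ω | W ω ≤ t})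
    (f : ℝ → ℝ) (hf : Measurable f) (hf_nonneg : ∀ x, 0 ≤ f x)
    (hf_density : P.map W = volume.withDensity (fun x => ENNReal.ofReal (f x))) :
    -- all the expectations, infima, suprema and integrals below are genuine
    (∀ (V : Type) [Fintype V] (G : SimpleGraph V),
      Integrable (GreedyMWIS.greedyRatio G) (Measure.pi (fun _ : V => P.map W))) ∧
    (∀ g : ℕ, (GreedyMWIS.expectedRatios (P.map W) g r).Nonempty ∧
      BddBelow (GreedyMWIS.expectedRatios (P.map W) g r) ∧
      BddAbove (GreedyMWIS.expectedRatios (P.map W) g r)) ∧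
    IntegrableOn (fun x : ℝ =>
      x * ((r : ℝ) - 1 - ((r : ℝ) - 2) * F x) ^ (-((r : ℝ) / ((r : ℝ) - 2))) * f x) (Ioi 0) ∧
    -- the two limits
    Tendsto (fun g : ℕ => sInf (GreedyMWIS.expectedRatios (P.map W) g r)) atTop
      (𝓝 (∫ x in Ioi (0 : ℝ),
        x * ((r : ℝ) - 1 - ((r : ℝ) - 2) * F x) ^ (-((r : ℝ) / ((r : ℝ) - 2))) * f x)) ∧
    Tendsto (fun g : ℕ => sSup (GreedyMWIS.expectedRatios (P.map W) g r)) atTop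
      (𝓝 (∫ x in Ioi (0 : ℝ),
        x * ((r : ℝ) - 1 - ((r : ℝ) - 2) * F x) ^ (-((r : ℝ) / ((r : ℝ) - 2))) * f x)) := by
  set ν := P.map W with hν_def
  have : IsProbabilityMeasure ν := Measure.isProbabilityMeasure_map hW.aemeasurable
  have : NullSingletonClass ν := ⟨fun x => by
    rw [hf_density]
    exact withDensity_absolutelyContinuous _ _ Real.volume_singleton⟩
  have hν : Integrable (fun x => x) ν :=
    (integrable_map_measure aestronglyMeasurable_id hW.aemeasurable).mpr hW_int
  have hν0 : ∀ᵐ x ∂ν, 0 ≤ x := (ae_map_iff hW.aemeasurable measurableSet_Ici).mpr hW_nonneg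
  have hFcdf : ∀ x, F x = ProbabilityTheory.cdf ν x := fun x => by
    rw [hF, ProbabilityTheory.cdf_eq_real, map_measureReal_apply hW measurableSet_Iic]
    rfl
  have hν_density : ν = volume.withDensity fun x => ((f x).toNNReal : ENNReal) := hf_density
  have hlim : ∀ x, GreedyMWIS.limitProb r (ProbabilityTheory.cdf ν x) ^ r =
      ((r : ℝ) - 1 - ((r : ℝ) - 2) * F x) ^ (-((r : ℝ) / ((r : ℝ) - 2))) := fun x => by
    rw [hFcdf, GreedyMWIS.limitProb_pow hr (ProbabilityTheory.cdf_le_one ν x)]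
  have hsmul : ∀ x, (f x).toNNReal • (x * GreedyMWIS.limitProb r (ProbabilityTheory.cdf ν x) ^ r) =
      x * ((r : ℝ) - 1 - ((r : ℝ) - 2) * F x) ^ (-((r : ℝ) / ((r : ℝ) - 2))) * f x := fun x => by
    rw [hlim, NNReal.smul_def, Real.coe_toNNReal _ (hf_nonneg x), smul_eq_mul, mul_comm]
  have hint : Integrable
      (fun x => x * GreedyMWIS.limitProb r (ProbabilityTheory.cdf ν x) ^ r) ν := by
    have hmeas : Measurable (fun x => GreedyMWIS.limitProb r (ProbabilityTheory.cdf ν x) ^ r) := by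
      have := (GreedyMWIS.continuous_cdf ν).measurable
      unfold GreedyMWIS.limitProb
      fun_prop
    refine hν.mul_bdd (c := 1) hmeas.aestronglyMeasurable (Eventually.of_forall fun x => ?_)
    have h := GreedyMWIS.limitProb_mem_Icc hr (ProbabilityTheory.cdf_le_one ν x)
    rw [Real.norm_of_nonneg (pow_nonneg h.1 r)]
    exact pow_le_one₀ h.1 h.2
  -- There is no atom at 0, so the law lives on the open half-line over which the integral is taken.
  have hpos : ∀ᵐ x ∂ν, x ∈ Ioi (0 : ℝ) := by
    have : ∀ᵐ x ∂ν, x ∉ ({0} : Set ℝ) := measure_eq_zero_iff_ae_notMem.mp (measure_singleton 0)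
    filter_upwards [hν0, this] with x h1 h2
    exact lt_of_le_of_ne h1 fun h => h2 h.symm
  have hsetint : ∀ g : ℝ → ℝ, ∫ x, g x ∂ν = ∫ x in Ioi 0, (f x).toNNReal • g x := fun g => by
    rw [← setIntegral_withDensity_eq_setIntegral_smul hf.real_toNNReal g measurableSet_Ioi,
      ← hν_density, Measure.restrict_eq_self_of_ae_mem hpos]
  have hsmul_int : ∀ g : ℝ → ℝ, Integrable g ν → Integrable fun x => (f x).toNNReal • g x :=
    fun g hg => by
      rw [hν_density] at hg
      exact (integrable_withDensity_iff_integrable_smul hf.real_toNNReal).mp hg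
  have hvalue : ∫ x, x * GreedyMWIS.limitProb r (ProbabilityTheory.cdf ν x) ^ r ∂ν =
      ∫ x in Ioi (0 : ℝ),
        x * ((r : ℝ) - 1 - ((r : ℝ) - 2) * F x) ^ (-((r : ℝ) / ((r : ℝ) - 2))) * f x := by
    rw [hsetint]
    simp_rw [hsmul]
  have hlimits := GreedyMWIS.tendsto_sInf_sSup_expectedRatios hν hν0 hr
  rw [hvalue] at hlimits
  refine ⟨fun V _ G => GreedyMWIS.integrable_greedyRatio hν G, fun g =>
    ⟨GreedyMWIS.expectedRatios_nonempty ν g r,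
      bddBelow_Icc.mono (GreedyMWIS.expectedRatios_subset_Icc hν g r),
      bddAbove_Icc.mono (GreedyMWIS.expectedRatios_subset_Icc hν g r)⟩, ?_, hlimits⟩
  have h := hsmul_int _ hint
  simp_rw [hsmul] at h
  exact h.integrableOn
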